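/- Let $R$ be a commutative ring (for instance $R=\mathbb{Z}$) and work in the ring $R[[q]]$ of formal power series with the $q$-adic topology. For each of the following six choices of power series $b_j(q)$ ($j\ge1$), $c_d(q)$ ($d\ge1$) and $G(q)$, one has $b_j(q)\to1$ and $c_d(q)\to0$ $q$-adically, all the infinite sums and products below converge, and $$\sum_{N=0}^\infty\left[\prod_{j=1}^\infty b_j(q)-\prod_{j=1}^N b_j(q)\right]=\prod_{j=1}^\infty b_j(q)\,\sum_{d=1}^\infty c_d(q)+G(q).$$ (i) $b_j=\dfrac{1}{1-q^j}$, $\quad c_d=\dfrac{q^d}{1-q^d}$, $\quad G=0$; (ii) $b_j=\dfrac{1+q^j}{1-q^j}$, $\quad c_d=\dfrac{2q^d}{1-q^{2d}}$, $\quad G=0$; (iii) $b_j=\dfrac{1-q^{2j-1}}{1-q^{2j}}$, $\quad c_d=\dfrac{(-1)^dq^d}{1-q^d}$, $\quad G=0$; (iv) $b_j=1-q^j$, $\quad c_d=\dfrac{q^d}{1-q^d}$, $\quad G=\displaystyle\sum_{r=1}^\infty(-1)^r\left[(3r-1)q^{r(3r-1)/2}+3r\,q^{r(3r+1)/2}\right]$;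 (v) $b_j=\dfrac{1-q^j}{1+q^j}$, $\quad c_d=\dfrac{2q^d}{1-q^{2d}}$, $\quad G=4\displaystyle\sum_{r=1}^\infty(-1)^r r\,q^{r^2}$; (vi) $b_j=\dfrac{1-q^{2j}}{1-q^{2j+1}}$, $\quad c_d=\dfrac{(-1)^dq^d}{1-q^d}$, $\quad G=(1-q)\displaystyle\sum_{r=1}^\infty r\,q^{r(r+1)/2}$. -/

import Mathlib

open Filter Topology
open scoped PowerSeries PowerSeries.WithPiTopology

/-- The quotient `f / g` of formal power series over a commutative ring, for `g` invertible
(every denominator used below has constant coefficient `1`, hence is invertible). -/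
noncomputable def qDiv {R : Type*} [CommRing R] (f g : R⟦X⟧) : R⟦X⟧ :=
  f * Ring.inverse g

/-- The identity
`∑_{N ≥ 0} [∏_{j ≥ 1} b_j - ∏_{j = 1}^N b_j] = ∏_{j ≥ 1} b_j * ∑_{d ≥ 1} c_d + G`
in the ring of formal power series, where `b_j → 1` and `c_d → 0`, together with the convergence
of all the infinite products and sums in it. For `R` discrete, the topology on `R⟦X⟧` (that of
coefficientwise convergence) is the `X`-adic one. The values `b 0` and `c 0` play no role. -/
def MainIdentity {R : Type*} [CommRing R] [TopologicalSpace R] [DiscreteTopology R]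
    (b c : ℕ → R⟦X⟧) (G : R⟦X⟧) : Prop :=
  Tendsto b atTop (𝓝 1) ∧
  Tendsto c atTop (𝓝 0) ∧
  Multipliable (fun j : ℕ => b (j + 1)) ∧
  Summable (fun d : ℕ => c (d + 1)) ∧
  Summable (fun N : ℕ => (∏' j : ℕ, b (j + 1)) - ∏ j ∈ Finset.Icc 1 N, b j) ∧
  ∑' N : ℕ, ((∏' j : ℕ, b (j + 1)) - ∏ j ∈ Finset.Icc 1 N, b j) =
    (∏' j : ℕ, b (j + 1)) * (∑' d : ℕ, c (d + 1)) + G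

/-- The `r`-th term `(-1)^r [(3r-1) q^{r(3r-1)/2} + 3r q^{r(3r+1)/2}]`, for `r ≥ 1`. -/
noncomputable def pentagonalTerm (R : Type*) [CommRing R] (r : ℕ) : R⟦X⟧ :=
  (-1) ^ r * ((3 * (r : R⟦X⟧) - 1) * PowerSeries.X ^ (r * (3 * r - 1) / 2)
    + 3 * (r : R⟦X⟧) * PowerSeries.X ^ (r * (3 * r + 1) / 2))

/-- The `r`-th term `(-1)^r r q^{r^2}`. -/
noncomputable def squareTerm (R : Type*) [CommRing R] (r : ℕ) : R⟦X⟧ :=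
  (-1) ^ r * (r : R⟦X⟧) * PowerSeries.X ^ (r ^ 2)

/-- The `r`-th term `r q^{r(r+1)/2}`. -/
noncomputable def triangularTerm (R : Type*) [CommRing R] (r : ℕ) : R⟦X⟧ :=
  (r : R⟦X⟧) * PowerSeries.X ^ (r * (r + 1) / 2)

/-! Let P_n be the partial products. By Abel summation, ∑_{N<M} (P_M - P_N) is the derivative at x =
1 of (1 - x) ∑_{n<M} P_n x^n + P_M x^M, so each case comes from differentiating a q-series identity
at x = 1. The derivative is the ε-part at x = 1 + ε over the dual numbers, and truncating at M costs
only multiples of Q^M; what remains is algebra in a commutative ring, and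
`mainIdentity_of_X_pow_dvd` passes to the limit.

In (i)–(iii), P_n = ∏_{k<n} (1 - αQ^k)/(1 - Q^(k+1)) with (Q, α) = (q, 0), (q, -q), (q², q). The
q-binomial theorem gives the product of (1 - xαQ^k)/(1 - xQ^(k+1)), whose logarithmic derivative at
1 is ∑ c_d (`pow_dvd_sum_tails_qBinomial`).

In (iv)–(vi), P_n = ∏_{1≤j≤n} (1 - Q^j)/(1 - βQ^j) with (Q, β) = (q, 0), (q, -1), (q², q). Here x is
also inserted into the factors, so that the Rogers–Fine identity applies. Differentiating P_M
produces the product times ∑ c_d, and differentiating the theta-like side produces G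
(`pow_dvd_sum_tails_rogersFine`). In (vi) the d = 1 term of ∑ c_d comes from the theta-like side
too. -/

/-! ### Truncated q-binomial and Rogers–Fine identities. -/

section FiniteIdentities

variable {B : Type*} [CommRing B]

/-- A form of the recurrence `(1 - t) F(t) = (1 - α t) F(t Q)` for the partial sums of the
`q`-binomial series `F(t) = ∑ P n * t ^ n`. -/
theorem qBinomial_partialSum_shift (t Q α : B) (P : ℕ → B)
    (hP : ∀ n, P (n + 1) * (1 - Q ^ (n + 1)) = P n * (1 - α * Q ^ n)) (M : ℕ) :
    (1 - t) * ∑ n ∈ Finset.range M, P n * t ^ n + P M * t ^ M =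
      (1 - t * α) * ∑ n ∈ Finset.range M, P n * (t * Q) ^ n + P M * (t * Q) ^ M := by
  induction M with
  | zero => simp
  | succ M ih =>
    rw [Finset.sum_range_succ, Finset.sum_range_succ]
    have h := hP M
    simp only [mul_pow, pow_succ] at *
    linear_combination ih + (t ^ M * t) * h

/-- The `q`-binomial theorem for `∑ P n * t ^ n` at `t = x`, modulo `Q ^ M`, after multiplication
by `1 - x`. -/
theorem pow_dvd_qBinomial_sub_prod (x Q α : B) (P s : ℕ → B) (hP0 : P 0 = 1)
    (hP : ∀ n, P (n + 1) * (1 - Q ^ (n + 1)) = P n * (1 - α * Q ^ n))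
    (hu : ∀ k, IsUnit (1 - x * Q ^ (k + 1)))
    (hs : ∀ k, s k * (1 - x * Q ^ (k + 1)) = 1 - x * α * Q ^ k) (M : ℕ) :
    Q ^ M ∣ (1 - x) * ∑ n ∈ Finset.range M, P n * x ^ n + P M * x ^ M -
      ∏ k ∈ Finset.range M, s k := by
  rcases Nat.eq_zero_or_pos M with rfl | hM
  · simp
  -- `W k` is the truncation of (1 - t)F(t) at t = xQ^k. Modulo Q^M it satisfies W k = s k * W (k +
  -- 1), and W M = 1.
  set W : ℕ → B := fun k =>
    (1 - x * Q ^ k) * ∑ n ∈ Finset.range M, P n * (x * Q ^ k) ^ n + P M * (x * Q ^ k) ^ M with hW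
  have step : ∀ k, Q ^ M ∣ W k - s k * W (k + 1) := by
    intro k
    rw [← (hu k).dvd_mul_left]
    have h := qBinomial_partialSum_shift (x * Q ^ k) Q α P hP M
    rw [show x * Q ^ k * Q = x * Q ^ (k + 1) by ring] at h
    have h2 : (1 - x * Q ^ (k + 1)) * (W k - s k * W (k + 1)) =
        Q ^ M * (P M * (x * Q ^ k) ^ M * (x * α * Q ^ k - x * Q ^ (k + 1))) := by
      simp only [hW]
      rw [h, mul_sub, ← mul_assoc _ (s k), mul_comm _ (s k), hs]
      rw [show (x * Q ^ (k + 1)) ^ M = Q ^ M * (x * Q ^ k) ^ M by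
        rw [← mul_pow]; congr 1; ring]
      ring
    exact ⟨_, h2⟩
  have tele : ∀ K, Q ^ M ∣ W 0 - (∏ k ∈ Finset.range K, s k) * W K := by
    intro K
    induction K with
    | zero => simp
    | succ K ih =>
      have h := dvd_add ih ((step K).mul_left (∏ k ∈ Finset.range K, s k))
      rw [Finset.prod_range_succ]
      convert h using 1
      ring
  have hWM : Q ^ M ∣ W M - 1 := by
    obtain ⟨m, rfl⟩ : ∃ m, M = m + 1 := ⟨M - 1, by omega⟩
    have hsum : ∑ n ∈ Finset.range (m + 1), P n * (x * Q ^ (m + 1)) ^ n =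
        1 + Q ^ (m + 1) * (x * ∑ n ∈ Finset.range m, P (n + 1) * (x * Q ^ (m + 1)) ^ n) := by
      rw [Finset.sum_range_succ', hP0, Finset.mul_sum, Finset.mul_sum, add_comm]
      congr 1
      · ring
      · exact Finset.sum_congr rfl fun n _ => by ring
    refine ⟨x * (∑ n ∈ Finset.range m, P (n + 1) * (x * Q ^ (m + 1)) ^ n) * (1 - x * Q ^ (m + 1))
      - x + P (m + 1) * x * (x * Q ^ (m + 1)) ^ m, ?_⟩
    simp only [hW, hsum]
    ring
  have h := dvd_add (tele M) (hWM.mul_left (∏ k ∈ Finset.range M, s k))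
  convert h using 1
  simp only [hW, pow_zero, mul_one]
  ring

/-- One step of the iteration leading to the Rogers–Fine identity for
`∑ (∏ (1 - x Q ^ j) / (1 - x β Q ^ j)) * x ^ n`, for partial sums. -/
theorem rogersFine_partialSum_shift (x Q β : B) (r : ℕ → B)
    (hr : ∀ j, r (j + 1) * (1 - x * β * Q ^ (j + 1)) = 1 - x * Q ^ (j + 1)) (k M : ℕ) :
    (1 - x * Q ^ k) * ∑ n ∈ Finset.range M,
        (∏ i ∈ Finset.range n, r (k + i + 1)) * (x * Q ^ k) ^ n +
      (∏ i ∈ Finset.range M, r (k + i + 1)) * (x * Q ^ k) ^ M =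
    1 - x ^ 2 * Q ^ (2 * k + 1) +
      x ^ 2 * Q ^ (2 * k + 1) * (β - x * Q ^ (k + 1)) * r (k + 1) * ∑ n ∈ Finset.range M,
        (∏ i ∈ Finset.range n, r (k + 1 + i + 1)) * (x * Q ^ (k + 1)) ^ n +
      x ^ 2 * Q ^ (2 * k + 1) * Q ^ M *
        ((∏ i ∈ Finset.range M, r (k + i + 1)) * (x * Q ^ k) ^ M) := by
  induction M with
  | zero => simp
  | succ M ih =>
    rw [Finset.sum_range_succ, Finset.sum_range_succ]
    have h1 : r (k + 1) * ∏ i ∈ Finset.range M, r (k + 1 + i + 1) =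
        ∏ i ∈ Finset.range (M + 1), r (k + i + 1) := by
      rw [Finset.prod_range_succ', mul_comm]
      congr 1
      exact Finset.prod_congr rfl fun i _ => by congr 1; ring
    have h2 : (∏ i ∈ Finset.range (M + 1), r (k + i + 1)) * (1 - x * β * Q ^ (k + M + 1)) =
        (∏ i ∈ Finset.range M, r (k + i + 1)) * (1 - x * Q ^ (k + M + 1)) := by
      rw [Finset.prod_range_succ, mul_assoc, hr]
    generalize (∏ i ∈ Finset.range (M + 1), r (k + i + 1)) = U at *
    generalize (∏ i ∈ Finset.range M, r (k + i + 1)) = V at *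
    generalize (∏ i ∈ Finset.range M, r (k + 1 + i + 1)) = V' at *
    simp only [mul_pow, pow_succ, pow_add, pow_mul, pow_zero, one_mul] at *
    rw [mul_add, mul_add]
    linear_combination ih + (x ^ M * (Q ^ k) ^ M * x * Q ^ k) * h2 -
      x ^ 2 * (Q ^ k) ^ 2 * Q * (β - x * (Q ^ k * Q)) * (x ^ M * (Q ^ k) ^ M * Q ^ M) * h1

/-- The Rogers–Fine identity with `a = t = x` and `b = x β`, modulo `Q ^ M`, after multiplication
by `1 - x`. -/
theorem pow_dvd_rogersFine (x Q β : B) (r T : ℕ → B)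
    (hr : ∀ j, r (j + 1) * (1 - x * β * Q ^ (j + 1)) = 1 - x * Q ^ (j + 1))
    (hT0 : T 0 = 1)
    (hT : ∀ k, T (k + 1) * (1 - x * β * Q ^ (k + 1)) =
      T k * (x ^ 2 * Q ^ (2 * k + 1) * (β - x * Q ^ (k + 1))))
    (M : ℕ) (hTM : Q ^ M ∣ T M) :
    Q ^ M ∣ (1 - x) * ∑ n ∈ Finset.range M, (∏ i ∈ Finset.range n, r (i + 1)) * x ^ n +
      (∏ i ∈ Finset.range M, r (i + 1)) * x ^ M -
      ∑ k ∈ Finset.range M, T k * (1 - x ^ 2 * Q ^ (2 * k + 1)) := by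
  set W : ℕ → B := fun k => (1 - x * Q ^ k) * ∑ n ∈ Finset.range M,
      (∏ i ∈ Finset.range n, r (k + i + 1)) * (x * Q ^ k) ^ n +
    (∏ i ∈ Finset.range M, r (k + i + 1)) * (x * Q ^ k) ^ M with hW
  have step : ∀ k, Q ^ M ∣ T k * W k - T k * (1 - x ^ 2 * Q ^ (2 * k + 1)) -
      T (k + 1) * W (k + 1) := by
    intro k
    have h1 : T k * (x ^ 2 * Q ^ (2 * k + 1) * (β - x * Q ^ (k + 1))) * r (k + 1) =
        T (k + 1) * (1 - x * Q ^ (k + 1)) := by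
      rw [← hT, ← hr]; ring
    refine ⟨T k * (x ^ 2 * Q ^ (2 * k + 1)) *
        ((∏ i ∈ Finset.range M, r (k + i + 1)) * (x * Q ^ k) ^ M) -
      T (k + 1) * ((∏ i ∈ Finset.range M, r (k + 1 + i + 1)) * (x * Q ^ k) ^ M), ?_⟩
    simp only [hW]
    rw [rogersFine_partialSum_shift x Q β r hr k M]
    rw [show (x * Q ^ (k + 1)) ^ M = Q ^ M * (x * Q ^ k) ^ M by
        rw [← mul_pow]; congr 1; ring]
    linear_combination (∑ n ∈ Finset.range M,
        (∏ i ∈ Finset.range n, r (k + 1 + i + 1)) * (x * Q ^ (k + 1)) ^ n) * h1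
  have tele : ∀ K, Q ^ M ∣ W 0 - ∑ k ∈ Finset.range K, T k * (1 - x ^ 2 * Q ^ (2 * k + 1)) -
      T K * W K := by
    intro K
    induction K with
    | zero => simp [hT0]
    | succ K ih =>
      have h := dvd_add ih (step K)
      rw [Finset.sum_range_succ]
      convert h using 1
      ring
  have h := dvd_add (tele M) (hTM.mul_right (W M))
  convert h using 1
  simp only [hW, pow_zero, mul_one, zero_add]
  ring

end FiniteIdentities

/-! ### Differentiation at x = 1 by dual numbers. -/

section DualNumbers

open TrivSqZeroExt DualNumber

variable {A : Type*} [CommRing A]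

theorem DualNumber.dvd_fst_and_snd {q : A} {y : A[ε]} (h : (inl q : A[ε]) ∣ y) :
    q ∣ y.fst ∧ q ∣ y.snd := by
  obtain ⟨z, rfl⟩ := h
  exact ⟨⟨z.fst, by simp⟩, ⟨z.snd, by simp⟩⟩

theorem DualNumber.fst_one_add_eps_pow (n : ℕ) : ((1 + ε : A[ε]) ^ n).fst = 1 := by
  simp

theorem DualNumber.snd_one_add_eps_pow (n : ℕ) : ((1 + ε : A[ε]) ^ n).snd = n := by
  rw [snd_pow]; simp

theorem DualNumber.snd_one_add_eps_pow_mul_inl (n : ℕ) (y z : A) :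
    ((1 + ε : A[ε]) ^ n * inl y * (1 - (1 + ε) ^ 2 * inl z)).snd =
      n * y - (n + 2) * (y * z) := by
  rw [snd_mul, snd_mul, snd_one_add_eps_pow, snd_sub, snd_mul, snd_one_add_eps_pow]
  simp
  ring

/-- At `x = 1 + ε`, the `ε`-part of `(1 - x) ∑_{n < M} P n x ^ n + P M x ^ M` is
`∑_{n < M} (P M - P n)`, up to the `ε`-part of `P M`. -/
theorem DualNumber.snd_abel_sum (P : ℕ → A[ε]) (M : ℕ) :
    ((1 - (1 + ε)) * ∑ n ∈ Finset.range M, P n * (1 + ε) ^ n + P M * (1 + ε) ^ M).snd =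
      M * (P M).fst - ∑ n ∈ Finset.range M, (P n).fst + (P M).snd := by
  rw [snd_add, snd_mul, snd_mul, fst_one_add_eps_pow, snd_one_add_eps_pow, fst_sum]
  simp
  ring

theorem DualNumber.fst_abel_sum (P : ℕ → A[ε]) (M : ℕ) :
    ((1 - (1 + ε)) * ∑ n ∈ Finset.range M, P n * (1 + ε) ^ n + P M * (1 + ε) ^ M).fst =
      (P M).fst := by
  simp

/-- Logarithmic derivatives add under multiplication. -/
theorem DualNumber.prod_inl_mul_one_add_inr (b c : ℕ → A) (M : ℕ) :
    ∏ k ∈ Finset.range M, (inl (b k) * (1 + inr (c k)) : A[ε]) =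
      inl (∏ k ∈ Finset.range M, b k) * (1 + inr (∑ k ∈ Finset.range M, c k)) := by
  induction M with
  | zero => simp
  | succ M ih =>
    rw [Finset.prod_range_succ, ih, Finset.prod_range_succ, Finset.sum_range_succ]
    ext <;> simp
    ring

/-- The derivative at `x = 1` of the `q`-binomial theorem, modulo `Q ^ M`. -/
theorem pow_dvd_sum_tails_qBinomial (Q α : A) (b c : ℕ → A)
    (hu : ∀ k, IsUnit (1 - Q ^ (k + 1)))
    (hb : ∀ k, b k * (1 - Q ^ (k + 1)) = 1 - α * Q ^ k)
    (hc : ∀ k, c k * (1 - α * Q ^ k) = b k * Q ^ (k + 1) - α * Q ^ k) (M : ℕ) :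
    Q ^ M ∣ M * ∏ k ∈ Finset.range M, b k - ∑ n ∈ Finset.range M, ∏ k ∈ Finset.range n, b k -
      (∏ k ∈ Finset.range M, b k) * ∑ k ∈ Finset.range M, c k := by
  have h := pow_dvd_qBinomial_sub_prod (1 + ε : A[ε]) (inl Q) (inl α)
    (fun n => inl (∏ k ∈ Finset.range n, b k)) (fun k => inl (b k) * (1 + inr (c k)))
    (by simp)
    (fun n => by
      ext
      · simp [Finset.prod_range_succ, mul_assoc, hb]
      · simp)
    (fun k => by simpa [isUnit_iff_isUnit_fst] using hu k)
    (fun k => by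
      ext
      · simpa using hb k
      · simp
        linear_combination c k * hb k + hc k) M
  rw [inl_pow] at h
  have h2 := (DualNumber.dvd_fst_and_snd h).2
  rw [snd_sub, DualNumber.snd_abel_sum, DualNumber.prod_inl_mul_one_add_inr] at h2
  simpa using h2

/-- The derivative at `x = 1` of the Rogers–Fine identity with `a = t = x` and `b = x β`,
modulo `Q ^ M`. -/
theorem pow_dvd_sum_tails_rogersFine (Q β : A) (b c : ℕ → A) (T : ℕ → A[ε])
    (hb : ∀ k, b k * (1 - β * Q ^ (k + 1)) = 1 - Q ^ (k + 1))
    (hc : ∀ k, c k * (1 - Q ^ (k + 1)) = Q ^ (k + 1) - b k * β * Q ^ (k + 1))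
    (hT0 : T 0 = 1)
    (hT : ∀ k, T (k + 1) * (1 - (1 + ε) * inl (β * Q ^ (k + 1))) =
      T k * ((1 + ε) ^ 2 * inl (Q ^ (2 * k + 1)) * (inl β - (1 + ε) * inl (Q ^ (k + 1)))))
    (M : ℕ) (hTM : inl (Q ^ M) ∣ T M) :
    Q ^ M ∣ ∏ k ∈ Finset.range M, b k -
        ∑ k ∈ Finset.range M, (T k * (1 - (1 + ε) ^ 2 * inl (Q ^ (2 * k + 1)))).fst ∧
    Q ^ M ∣ M * ∏ k ∈ Finset.range M, b k - ∑ n ∈ Finset.range M, ∏ k ∈ Finset.range n, b k -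
      (∏ k ∈ Finset.range M, b k) * ∑ k ∈ Finset.range M, c k -
        ∑ k ∈ Finset.range M, (T k * (1 - (1 + ε) ^ 2 * inl (Q ^ (2 * k + 1)))).snd := by
  have h := pow_dvd_rogersFine (1 + ε : A[ε]) (inl Q) (inl β)
    -- The factors are indexed from 1; the value at n = 0 never enters. The sign reflects that `c`
    -- is minus the logarithmic derivative.
    (fun n => inl (b (n - 1)) * (1 + inr (- c (n - 1)))) T
    (fun k => by
      ext
      · simpa using hb k
      · simp
        linear_combination (- c k) * hb k - hc k)
    hT0 (fun k => by simpa only [mul_assoc, inl_pow, inl_mul] using hT k) M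
    (by rwa [inl_pow])
  simp only [Nat.add_sub_cancel, DualNumber.prod_inl_mul_one_add_inr] at h
  simp only [inl_pow] at h
  have h2 := DualNumber.dvd_fst_and_snd h
  rw [snd_sub, DualNumber.snd_abel_sum, fst_sub, DualNumber.fst_abel_sum, fst_sum, snd_sum] at h2
  refine ⟨?_, ?_⟩
  · simpa only [fst_mul, fst_inl, fst_add, fst_one, fst_inr, add_zero, mul_one] using h2.1
  · convert h2.2 using 2
    simp
    ring

end DualNumbers

/-! ### X-adic convergence and passage to the limit. -/

section Convergence

theorem X_pow_dvd_prod_range_sub {R : Type*} [CommRing R] {f : ℕ → R⟦X⟧}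
    (h : ∀ n, PowerSeries.X ^ n ∣ f n - 1) {N M : ℕ} (hNM : N ≤ M) :
    PowerSeries.X ^ N ∣ ∏ j ∈ Finset.range M, f j - ∏ j ∈ Finset.range N, f j := by
  induction M, hNM using Nat.le_induction with
  | base => simp
  | succ M hM ih =>
    rw [Finset.prod_range_succ]
    convert dvd_add (((pow_dvd_pow _ hM).trans (h M)).mul_left (∏ j ∈ Finset.range M, f j)) ih
      using 1
    ring

theorem tendsto_order_of_X_pow_dvd {R : Type*} [CommRing R] {f : ℕ → R⟦X⟧}
    (h : ∀ n, PowerSeries.X ^ n ∣ f n) : Tendsto (fun n => (f n).order) atTop (𝓝 ⊤) := by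
  rw [ENat.tendsto_nhds_top_iff_natCast_lt]
  intro n
  filter_upwards [eventually_gt_atTop n] with m hm
  exact lt_of_lt_of_le (by exact_mod_cast hm)
    (PowerSeries.nat_le_order _ m (PowerSeries.X_pow_dvd_iff.mp (h m)))

theorem tendsto_zero_of_X_pow_dvd {R : Type*} [CommRing R] [TopologicalSpace R] {f : ℕ → R⟦X⟧}
    (h : ∀ n, PowerSeries.X ^ n ∣ f n) : Tendsto f atTop (𝓝 0) := by
  rw [PowerSeries.WithPiTopology.tendsto_iff_coeff_tendsto]
  intro d
  refine tendsto_const_nhds.congr' ?_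
  filter_upwards [eventually_gt_atTop d] with n hn
  rw [PowerSeries.X_pow_dvd_iff.mp (h n) d hn, map_zero]

variable {R : Type*} [CommRing R] [TopologicalSpace R]

theorem summable_of_X_pow_dvd {f : ℕ → R⟦X⟧} (h : ∀ n, PowerSeries.X ^ n ∣ f n) : Summable f :=
  PowerSeries.WithPiTopology.summable_of_tendsto_order_atTop_nhds_top _
    (tendsto_order_of_X_pow_dvd h)

theorem multipliable_of_X_pow_dvd {f : ℕ → R⟦X⟧} (h : ∀ n, PowerSeries.X ^ n ∣ f n - 1) :
    Multipliable f := by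
  have := PowerSeries.WithPiTopology.multipliable_one_add_of_tendsto_order_atTop_nhds_top _
    (tendsto_order_of_X_pow_dvd h)
  simpa using this

theorem tendsto_sum_range_of_X_pow_dvd {c : ℕ → R⟦X⟧} (hc : ∀ d, PowerSeries.X ^ d ∣ c d) :
    Tendsto (fun M => ∑ d ∈ Finset.range M, c (d + 1)) atTop (𝓝 (∑' d, c (d + 1))) :=
  (summable_of_X_pow_dvd
    fun d => (pow_dvd_pow _ d.le_succ).trans (hc (d + 1))).hasSum.tendsto_sum_nat

variable [DiscreteTopology R]

theorem X_pow_dvd_of_tendsto {f : ℕ → R⟦X⟧} {g : R⟦X⟧} {n : ℕ} (hf : Tendsto f atTop (𝓝 g))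
    (h : ∀ᶠ m in atTop, PowerSeries.X ^ n ∣ f m) : PowerSeries.X ^ n ∣ g := by
  rw [PowerSeries.X_pow_dvd_iff]
  intro d hd
  rw [PowerSeries.WithPiTopology.tendsto_iff_coeff_tendsto] at hf
  refine tendsto_nhds_unique (hf d) (tendsto_const_nhds.congr' ?_)
  filter_upwards [h] with m hm
  rw [PowerSeries.X_pow_dvd_iff.mp hm d hd]

/-- To prove the main identity it suffices to control `∑_{N < M} (P_M - P_N)` as `M → ∞`. -/
theorem mainIdentity_of_tendsto {b c : ℕ → R⟦X⟧} {G : R⟦X⟧}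
    (hb : ∀ j, PowerSeries.X ^ j ∣ b j - 1) (hc : ∀ d, PowerSeries.X ^ d ∣ c d)
    (h : Tendsto (fun M : ℕ => (M : R⟦X⟧) * ∏ k ∈ Finset.range M, b (k + 1) -
        ∑ n ∈ Finset.range M, ∏ k ∈ Finset.range n, b (k + 1)) atTop
      (𝓝 ((∏' j : ℕ, b (j + 1)) * (∑' d : ℕ, c (d + 1)) + G))) :
    MainIdentity b c G := by
  have hb' : ∀ j, PowerSeries.X ^ j ∣ b (j + 1) - 1 := fun j =>
    (pow_dvd_pow _ j.le_succ).trans (hb _)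
  have hmul : Multipliable (fun j : ℕ => b (j + 1)) := multipliable_of_X_pow_dvd hb'
  have hprod : ∀ N, ∏ j ∈ Finset.Icc 1 N, b j = ∏ k ∈ Finset.range N, b (k + 1) := by
    intro N
    induction N with
    | zero => simp
    | succ N ih => rw [Finset.prod_Icc_succ_top (by omega), ih, Finset.prod_range_succ]
  have hlim := hmul.hasProd.tendsto_prod_nat
  have htail : ∀ N, PowerSeries.X ^ N ∣
      (∏' j : ℕ, b (j + 1)) - ∏ k ∈ Finset.range N, b (k + 1) := fun N =>
    X_pow_dvd_of_tendsto (hlim.sub_const _) <| by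
      filter_upwards [eventually_ge_atTop N] with M hM
      exact X_pow_dvd_prod_range_sub hb' hM
  have hsum := summable_of_X_pow_dvd htail
  refine ⟨?_, tendsto_zero_of_X_pow_dvd hc, hmul,
    summable_of_X_pow_dvd fun d => (pow_dvd_pow _ d.le_succ).trans (hc _), ?_, ?_⟩
  · simpa using (tendsto_zero_of_X_pow_dvd hb).add_const 1
  · simpa only [hprod] using hsum
  · simp only [hprod]
    refine tendsto_nhds_unique hsum.hasSum.tendsto_sum_nat ?_
    -- Replacing P_M by the infinite product in all M summands costs M times a multiple of X^M.
    have h0 := tendsto_zero_of_X_pow_dvd fun M => (htail M).mul_left (M : R⟦X⟧)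
    have := h.add h0
    rw [add_zero] at this
    refine this.congr fun M => ?_
    rw [Finset.sum_sub_distrib, Finset.sum_const, Finset.card_range, nsmul_eq_mul]
    ring

/-- Only the combined limit of `D` and `E` must match, so `D` may run over 2M terms, or omit a term
of ∑ c_d that `E` supplies. -/
theorem mainIdentity_of_X_pow_dvd {b c D E : ℕ → R⟦X⟧} {G D' E' : R⟦X⟧}
    (hb : ∀ j, PowerSeries.X ^ j ∣ b j - 1) (hc : ∀ d, PowerSeries.X ^ d ∣ c d)
    (hD : Tendsto D atTop (𝓝 D')) (hE : Tendsto E atTop (𝓝 E'))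
    (h : ∀ M : ℕ, PowerSeries.X ^ M ∣ (M : R⟦X⟧) * ∏ k ∈ Finset.range M, b (k + 1) -
        ∑ n ∈ Finset.range M, ∏ k ∈ Finset.range n, b (k + 1) -
        (∏ k ∈ Finset.range M, b (k + 1)) * D M - E M)
    (hG : (∏' j : ℕ, b (j + 1)) * D' + E' =
      (∏' j : ℕ, b (j + 1)) * (∑' d : ℕ, c (d + 1)) + G) :
    MainIdentity b c G := by
  refine mainIdentity_of_tendsto hb hc ?_
  have hmul := multipliable_of_X_pow_dvd fun j => (pow_dvd_pow _ j.le_succ).trans (hb (j + 1))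
  have := ((tendsto_zero_of_X_pow_dvd h).add (hmul.hasProd.tendsto_prod_nat.mul hD)).add hE
  rw [zero_add, hG] at this
  exact this.congr fun M => by ring

end Convergence

/-! ### Quotients of power series. -/

section Quotients

variable {R : Type*} [CommRing R]

theorem isUnit_one_sub_X_pow {n : ℕ} (hn : n ≠ 0) : IsUnit (1 - PowerSeries.X ^ n : R⟦X⟧) := by
  rw [PowerSeries.isUnit_iff_constantCoeff]; simp [hn]

theorem isUnit_one_add_X_pow {n : ℕ} (hn : n ≠ 0) : IsUnit (1 + PowerSeries.X ^ n : R⟦X⟧) := by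
  rw [PowerSeries.isUnit_iff_constantCoeff]; simp [hn]

theorem qDiv_mul_cancel (f : R⟦X⟧) {g : R⟦X⟧} (hg : IsUnit g) : qDiv f g * g = f := by
  rw [qDiv, mul_assoc, Ring.inverse_mul_cancel g hg, mul_one]

theorem dvd_qDiv {p f : R⟦X⟧} (g : R⟦X⟧) (h : p ∣ f) : p ∣ qDiv f g :=
  h.mul_right _

theorem dvd_qDiv_sub_one {p f g : R⟦X⟧} (hg : IsUnit g) (h : p ∣ f - g) : p ∣ qDiv f g - 1 := by
  rw [← hg.dvd_mul_right, sub_mul, qDiv_mul_cancel f hg, one_mul]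
  exact h

end Quotients

/-! ### The six cases. -/

section Identities

open PowerSeries TrivSqZeroExt DualNumber

theorem sum_range_two_mul {A : Type*} [AddCommMonoid A] (f : ℕ → A) (M : ℕ) :
    ∑ d ∈ Finset.range (2 * M), f d = ∑ k ∈ Finset.range M, (f (2 * k) + f (2 * k + 1)) := by
  induction M with
  | zero => simp
  | succ M ih =>
    rw [mul_add_one, Finset.sum_range_succ, Finset.sum_range_succ, ih, Finset.sum_range_succ,
      add_assoc]

variable (R : Type*) [CommRing R]

theorem X_pow_dvd_pentagonalTerm (r : ℕ) : X ^ r ∣ pentagonalTerm R r := by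
  rcases Nat.eq_zero_or_pos r with rfl | hr
  · simp
  refine Dvd.dvd.mul_left (dvd_add ?_ ?_) _ <;> refine Dvd.dvd.mul_left (pow_dvd_pow _ ?_) _
  · rw [Nat.le_div_iff_mul_le (by norm_num)]
    exact Nat.mul_le_mul_left r (by omega)
  · rw [Nat.le_div_iff_mul_le (by norm_num)]
    exact Nat.mul_le_mul_left r (by omega)

theorem X_pow_dvd_squareTerm (r : ℕ) : X ^ r ∣ squareTerm R r :=
  Dvd.dvd.mul_left (pow_dvd_pow _ (by nlinarith)) _

theorem X_pow_dvd_triangularTerm (r : ℕ) : X ^ r ∣ triangularTerm R r := by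
  rcases Nat.eq_zero_or_pos r with rfl | hr
  · simp
  refine Dvd.dvd.mul_left (pow_dvd_pow _ ?_) _
  rw [Nat.le_div_iff_mul_le (by norm_num)]
  exact Nat.mul_le_mul_left r (by omega)

theorem triangularTerm_two_mul_add (k : ℕ) :
    triangularTerm R (2 * k) + triangularTerm R (2 * k + 1) =
      X ^ (k * (2 * k + 1)) * (2 * (k : R⟦X⟧) + (2 * (k : R⟦X⟧) + 1) * X ^ (2 * k + 1)) := by
  rw [triangularTerm, triangularTerm, mul_assoc 2 k, Nat.mul_div_cancel_left _ two_pos,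
    show (2 * k + 1) * (2 * k + 1 + 1) = 2 * (k * (2 * k + 1) + (2 * k + 1)) by ring,
    Nat.mul_div_cancel_left _ two_pos]
  push_cast
  ring

theorem isUnit_one_sub_one_add_eps_mul (k : ℕ) :
    IsUnit (1 - (1 + ε) * inl (X ^ (2 * k + 1)) : R⟦X⟧[ε]) := by
  simpa [isUnit_iff_isUnit_fst] using isUnit_one_sub_X_pow (R := R) (n := 2 * k + 1) (by omega)

/-- 1 - x²X^(4k+2) factors as a difference of squares, which cancels the denominator of `T k`. -/
theorem rogersFine_term_even_div_odd (k : ℕ) :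
    (1 + ε) ^ (2 * k) * inl (X ^ (k * (2 * k + 1))) * (1 - (1 + ε) * inl X) *
    Ring.inverse (1 - (1 + ε) * inl (X ^ (2 * k + 1))) *
      (1 - (1 + ε) ^ 2 * inl ((X ^ 2) ^ (2 * k + 1))) =
    ((1 + ε) ^ (2 * k) * (inl (X ^ (k * (2 * k + 1))) * (1 - (1 + ε) * inl X) *
      (1 + (1 + ε) * inl (X ^ (2 * k + 1)))) : R⟦X⟧[ε]) := by
  have h1 := Ring.inverse_mul_cancel _ (isUnit_one_sub_one_add_eps_mul R k)
  simp only [← inl_pow] at *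
  linear_combination ((1 + ε) ^ (2 * k) * inl X ^ (k * (2 * k + 1)) * (1 - (1 + ε) * inl X) *
      (1 + (1 + ε) * inl X ^ (2 * k + 1))) * h1

theorem fst_rogersFine_term_even_div_odd (k : ℕ) :
    ((1 + ε) ^ (2 * k) * (inl (X ^ (k * (2 * k + 1))) *
    (1 - (1 + ε) * inl X) * (1 + (1 + ε) * inl (X ^ (2 * k + 1)))) : R⟦X⟧[ε]).fst =
    X ^ (k * (2 * k + 1)) * (1 - X) * (1 + X ^ (2 * k + 1)) := by
  simp

/-- Product rule: the last term comes from the factor 1 - xX, with logarithmic derivative -X/(1 -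
X); the rest gives two triangular terms. -/
theorem snd_rogersFine_term_even_div_odd (k : ℕ) :
    ((1 + ε) ^ (2 * k) * (inl (X ^ (k * (2 * k + 1))) *
    (1 - (1 + ε) * inl X) * (1 + (1 + ε) * inl (X ^ (2 * k + 1)))) : R⟦X⟧[ε]).snd =
    (1 - X) * (triangularTerm R (2 * k) + triangularTerm R (2 * k + 1)) -
      qDiv X (1 - X) * (X ^ (k * (2 * k + 1)) * (1 - X) * (1 + X ^ (2 * k + 1))) := by
  have h1 := qDiv_mul_cancel (R := R) X (g := 1 - X)
    (by simpa using isUnit_one_sub_X_pow (R := R) one_ne_zero)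
  rw [DualNumber.snd_mul, DualNumber.snd_one_add_eps_pow, DualNumber.fst_one_add_eps_pow,
    triangularTerm_two_mul_add]
  simp
  linear_combination X ^ (k * (2 * k + 1)) * (1 + X ^ (2 * k + 1)) * h1

theorem X_pow_dvd_sum_tails_even_div_odd (M : ℕ) :
    (X : R⟦X⟧) ^ M ∣
      ∏ k ∈ Finset.range M, qDiv (1 - X ^ (2 * (k + 1))) (1 - X ^ (2 * (k + 1) + 1)) -
        ∑ k ∈ Finset.range M, X ^ (k * (2 * k + 1)) * (1 - X) * (1 + X ^ (2 * k + 1)) ∧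
    (X : R⟦X⟧) ^ M ∣
      (M : R⟦X⟧) * ∏ k ∈ Finset.range M,
        qDiv (1 - X ^ (2 * (k + 1))) (1 - X ^ (2 * (k + 1) + 1)) -
      ∑ n ∈ Finset.range M, ∏ k ∈ Finset.range n,
        qDiv (1 - X ^ (2 * (k + 1))) (1 - X ^ (2 * (k + 1) + 1)) -
      (∏ k ∈ Finset.range M, qDiv (1 - X ^ (2 * (k + 1))) (1 - X ^ (2 * (k + 1) + 1))) *
        ∑ d ∈ Finset.range (2 * M),
          qDiv ((-1) ^ (d + 1 + 1) * X ^ (d + 1 + 1)) (1 - X ^ (d + 1 + 1)) -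
      ((1 - X) * ∑ m ∈ Finset.range (2 * M), triangularTerm R m -
        qDiv X (1 - X) *
          ∑ k ∈ Finset.range M, X ^ (k * (2 * k + 1)) * (1 - X) * (1 + X ^ (2 * k + 1))) := by
  have h := pow_dvd_sum_tails_rogersFine (X ^ 2 : R⟦X⟧) X
    (fun k => qDiv (1 - X ^ (2 * (k + 1))) (1 - X ^ (2 * (k + 1) + 1)))
    (fun k => qDiv ((-1) ^ (2 * k + 1 + 1) * X ^ (2 * k + 1 + 1)) (1 - X ^ (2 * k + 1 + 1)) +
      qDiv ((-1) ^ (2 * k + 1 + 1 + 1) * X ^ (2 * k + 1 + 1 + 1)) (1 - X ^ (2 * k + 1 + 1 + 1)))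
    -- The ratio T (k+1) / T k is x²X^(4k+3)(1 - xX^(2k+1))/(1 - xX^(2k+3)), so the fractions
    -- telescope.
    (fun k => (1 + ε) ^ (2 * k) * inl (X ^ (k * (2 * k + 1))) * (1 - (1 + ε) * inl X) *
      Ring.inverse (1 - (1 + ε) * inl (X ^ (2 * k + 1))))
    (fun k => by
      rw [← pow_mul, ← pow_succ', qDiv_mul_cancel _ (isUnit_one_sub_X_pow (by omega))])
    (fun k => by
      have hu := isUnit_one_sub_X_pow (R := R) (n := 2 * (k + 1) + 1) (by omega)
      have h1 := qDiv_mul_cancel (1 - X ^ (2 * (k + 1))) hu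
      have h2 := qDiv_mul_cancel ((-1) ^ (2 * (k + 1)) * X ^ (2 * (k + 1)))
        (isUnit_one_sub_X_pow (R := R) (n := 2 * (k + 1)) (by omega))
      have h3 := qDiv_mul_cancel ((-1) ^ (2 * (k + 1) + 1) * X ^ (2 * (k + 1) + 1)) hu
      rw [show 2 * k + 1 + 1 = 2 * (k + 1) by ring, ← pow_mul]
      rw [(even_two_mul (k + 1)).neg_one_pow] at h2 ⊢
      rw [(odd_two_mul_add_one (k + 1)).neg_one_pow] at h3 ⊢
      refine hu.mul_right_cancel ?_
      linear_combination (1 - X ^ (2 * (k + 1) + 1)) * h2 + (1 - X ^ (2 * (k + 1))) * h3 +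
        X ^ (2 * (k + 1) + 1) * h1)
    (by simpa using Ring.mul_inverse_cancel _ (isUnit_one_sub_one_add_eps_mul R 0))
    (fun k => by
      rw [← pow_mul, ← pow_succ', mul_assoc _ (Ring.inverse _), Ring.inverse_mul_cancel _
        (isUnit_one_sub_one_add_eps_mul R (k + 1))]
      have h1 := Ring.inverse_mul_cancel _ (isUnit_one_sub_one_add_eps_mul R k)
      simp only [← inl_pow] at *
      linear_combination (-(1 + ε) ^ (2 * k) * inl X ^ (k * (2 * k + 1)) * (1 - (1 + ε) * inl X) *
        ((1 + ε) ^ 2 * inl X ^ (4 * k + 3))) * h1)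
    M (by
      refine (((map_dvd (inlHom R⟦X⟧ R⟦X⟧) ?_).mul_left _).mul_right _).mul_right _
      rw [← pow_mul]
      exact pow_dvd_pow _ (by nlinarith [Nat.le_mul_self M]))
  simp only [rogersFine_term_even_div_odd, fst_rogersFine_term_even_div_odd,
    snd_rogersFine_term_even_div_odd] at h
  have hdvd : (X : R⟦X⟧) ^ M ∣ (X ^ 2) ^ M := pow_dvd_pow_of_dvd (dvd_pow_self X two_ne_zero) M
  refine ⟨hdvd.trans h.1, hdvd.trans ?_⟩
  rw [Finset.sum_sub_distrib, ← Finset.mul_sum, ← Finset.mul_sum] at h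
  rw [sum_range_two_mul, sum_range_two_mul]
  exact h.2

variable [TopologicalSpace R] [DiscreteTopology R]

theorem mainIdentity_inv_one_sub :
    MainIdentity (fun j => qDiv 1 (1 - X ^ j : R⟦X⟧)) (fun d => qDiv (X ^ d) (1 - X ^ d)) 0 := by
  have hc : ∀ d, (X : R⟦X⟧) ^ d ∣ qDiv (X ^ d) (1 - X ^ d) := fun d => dvd_qDiv _ dvd_rfl
  have hb : ∀ j, (X : R⟦X⟧) ^ j ∣ qDiv 1 (1 - X ^ j) - 1 := fun j => by
    -- At j = 0 the denominator is not a unit, but X^0 divides everything.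
    rcases Nat.eq_zero_or_pos j with rfl | hj
    · simp
    · exact dvd_qDiv_sub_one (isUnit_one_sub_X_pow hj.ne') (by simp)
  refine mainIdentity_of_X_pow_dvd hb hc (tendsto_sum_range_of_X_pow_dvd hc) tendsto_const_nhds
    (E' := 0) (fun M => ?_) rfl
  rw [sub_zero]
  refine pow_dvd_sum_tails_qBinomial X 0 _ _ (fun k => isUnit_one_sub_X_pow k.succ_ne_zero)
    (fun k => ?_) (fun k => ?_) M
  · rw [qDiv_mul_cancel _ (isUnit_one_sub_X_pow k.succ_ne_zero)]; simp
  · simp [qDiv, mul_comm]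

theorem mainIdentity_one_add_div_one_sub :
    MainIdentity (fun j => qDiv (1 + X ^ j) (1 - X ^ j : R⟦X⟧))
      (fun d => qDiv (2 * X ^ d) (1 - X ^ (2 * d))) 0 := by
  have hc : ∀ d, (X : R⟦X⟧) ^ d ∣ qDiv (2 * X ^ d) (1 - X ^ (2 * d)) := fun d =>
    dvd_qDiv _ (Dvd.intro_left _ rfl)
  have hb : ∀ j, (X : R⟦X⟧) ^ j ∣ qDiv (1 + X ^ j) (1 - X ^ j) - 1 := fun j => by
    rcases Nat.eq_zero_or_pos j with rfl | hj
    · simp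
    · exact dvd_qDiv_sub_one (isUnit_one_sub_X_pow hj.ne') ⟨2, by ring⟩
  refine mainIdentity_of_X_pow_dvd hb hc (tendsto_sum_range_of_X_pow_dvd hc) tendsto_const_nhds
    (E' := 0) (fun M => ?_) rfl
  rw [sub_zero]
  refine pow_dvd_sum_tails_qBinomial X (-X) _ _ (fun k => isUnit_one_sub_X_pow k.succ_ne_zero)
    (fun k => ?_) (fun k => ?_) M
  · rw [qDiv_mul_cancel _ (isUnit_one_sub_X_pow k.succ_ne_zero)]; ring
  · have hu := isUnit_one_sub_X_pow (R := R) (n := k + 1) k.succ_ne_zero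
    have h1 := qDiv_mul_cancel (1 + X ^ (k + 1)) hu
    have h2 := qDiv_mul_cancel (2 * X ^ (k + 1))
      (isUnit_one_sub_X_pow (R := R) (n := 2 * (k + 1)) (by omega))
    refine hu.mul_right_cancel ?_
    linear_combination h2 - X ^ (k + 1) * h1


theorem mainIdentity_odd_div_even :
    MainIdentity (fun j => qDiv (1 - X ^ (2 * j - 1)) (1 - X ^ (2 * j) : R⟦X⟧))
      (fun d => qDiv ((-1) ^ d * X ^ d) (1 - X ^ d)) 0 := by
  have hc : ∀ d, (X : R⟦X⟧) ^ d ∣ qDiv ((-1) ^ d * X ^ d) (1 - X ^ d) := fun d =>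
    dvd_qDiv _ (Dvd.intro_left _ rfl)
  have hb : ∀ j, (X : R⟦X⟧) ^ j ∣ qDiv (1 - X ^ (2 * j - 1)) (1 - X ^ (2 * j)) - 1 := fun j => by
    rcases Nat.eq_zero_or_pos j with rfl | hj
    · simp
    · refine dvd_qDiv_sub_one (isUnit_one_sub_X_pow (by omega)) ?_
      rw [sub_sub_sub_cancel_left]
      exact dvd_sub (pow_dvd_pow _ (by omega)) (pow_dvd_pow _ (by omega))
  -- The k-th factor contributes the two terms d = 2k+1 and d = 2k+2.
  have hD := (tendsto_sum_range_of_X_pow_dvd hc).comp (tendsto_id.const_mul_atTop' two_pos)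
  refine mainIdentity_of_X_pow_dvd hb hc hD tendsto_const_nhds (E' := 0) (fun M => ?_) rfl
  rw [sub_zero]
  simp only [Function.comp_apply, id, sum_range_two_mul]
  refine (pow_dvd_pow_of_dvd (dvd_pow_self X two_ne_zero) M).trans
    (pow_dvd_sum_tails_qBinomial (X ^ 2) X _ _ (fun k => ?_) (fun k => ?_) (fun k => ?_) M)
  · rw [← pow_mul]; exact isUnit_one_sub_X_pow (by omega)
  · rw [← pow_mul, qDiv_mul_cancel _ (isUnit_one_sub_X_pow (by omega)),
      show 2 * (k + 1) - 1 = 2 * k + 1 by omega]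
    ring
  · have hu := isUnit_one_sub_X_pow (R := R) (n := 2 * (k + 1)) (by omega)
    have h1 := qDiv_mul_cancel (1 - X ^ (2 * (k + 1) - 1)) hu
    have h2 := qDiv_mul_cancel ((-1) ^ (2 * k + 1) * X ^ (2 * k + 1))
      (isUnit_one_sub_X_pow (R := R) (n := 2 * k + 1) (by omega))
    have h3 := qDiv_mul_cancel ((-1) ^ (2 * (k + 1)) * X ^ (2 * (k + 1))) hu
    rw [(odd_two_mul_add_one k).neg_one_pow] at h2 ⊢
    rw [(even_two_mul (k + 1)).neg_one_pow] at h3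
    rw [show 2 * k + 1 + 1 = 2 * (k + 1) by ring, (even_two_mul (k + 1)).neg_one_pow]
    rw [show 2 * (k + 1) - 1 = 2 * k + 1 by omega] at h1 ⊢
    refine hu.mul_right_cancel ?_
    linear_combination (1 - X ^ (2 * (k + 1))) * h2 + (1 - X ^ (2 * k + 1)) * h3 -
      X ^ (2 * (k + 1)) * h1

theorem mainIdentity_one_sub :
    MainIdentity (fun j => (1 - X ^ j : R⟦X⟧)) (fun d => qDiv (X ^ d) (1 - X ^ d))
      (∑' r : ℕ, pentagonalTerm R (r + 1)) := by
  have hc : ∀ d, (X : R⟦X⟧) ^ d ∣ qDiv (X ^ d) (1 - X ^ d) := fun d => dvd_qDiv _ dvd_rfl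
  have hb : ∀ j, (X : R⟦X⟧) ^ j ∣ 1 - X ^ j - 1 := fun j => by simp
  have hexp : ∀ k : ℕ, (k + 1) * (3 * (k + 1) + 1) / 2 = k * (3 * k + 1) / 2 + (3 * k + 2) := by
    intro k
    rw [← Nat.add_mul_div_right _ _ two_pos]
    congr 1
    ring
  have hexp' : ∀ k : ℕ, (k + 1) * (3 * (k + 1) - 1) / 2 = k * (3 * k + 1) / 2 + (2 * k + 1) := by
    intro k
    rw [← Nat.add_mul_div_right _ _ two_pos, show 3 * (k + 1) - 1 = 3 * k + 2 by omega]
    congr 1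
    ring
  refine mainIdentity_of_X_pow_dvd hb hc (tendsto_sum_range_of_X_pow_dvd hc)
    (tendsto_sum_range_of_X_pow_dvd (X_pow_dvd_pentagonalTerm R)) (fun M => ?_) rfl
  have hM : (X : R⟦X⟧) ^ M ∣ X ^ (M * (3 * M + 1) / 2) := by
    refine pow_dvd_pow _ ((Nat.le_div_iff_mul_le two_pos).mpr ?_)
    rcases Nat.eq_zero_or_pos M with rfl | h
    · simp
    · exact Nat.mul_le_mul_left M (by omega)
  have h := (pow_dvd_sum_tails_rogersFine (X : R⟦X⟧) 0 (fun k => 1 - X ^ (k + 1))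
    (fun k => qDiv (X ^ (k + 1)) (1 - X ^ (k + 1)))
    -- For β = 0 the ratio of consecutive terms is -x³X^(3k+2).
    (fun k => (1 + ε) ^ (3 * k) * inl ((-1) ^ k * X ^ (k * (3 * k + 1) / 2)))
    (fun k => by simp)
    (fun k => by rw [qDiv_mul_cancel _ (isUnit_one_sub_X_pow k.succ_ne_zero)]; simp)
    (by simp)
    (fun k => by
      simp only [hexp, inl_mul, ← inl_pow, zero_mul, inl_zero, inl_neg, inl_one]
      ring)
    M ((map_dvd (inlHom R⟦X⟧ R⟦X⟧) (hM.mul_left _)).mul_left _)).2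
  simp only [DualNumber.snd_one_add_eps_pow_mul_inl] at h
  -- Each pentagonal term pairs the second half of one Rogers–Fine term with the first half of the
  -- next, leaving a boundary term divisible by X^M.
  have hE : ∑ k ∈ Finset.range M, (((3 * k : ℕ) : R⟦X⟧) * ((-1) ^ k * X ^ (k * (3 * k + 1) / 2)) -
      (((3 * k : ℕ) : R⟦X⟧) + 2) * ((-1) ^ k * X ^ (k * (3 * k + 1) / 2) * X ^ (2 * k + 1))) =
      ∑ k ∈ Finset.range M, pentagonalTerm R (k + 1) -
        (-1) ^ M * (3 * (M : R⟦X⟧)) * X ^ (M * (3 * M + 1) / 2) := by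
    clear h hM
    induction M with
    | zero => simp
    | succ M ih =>
      rw [Finset.sum_range_succ, ih, Finset.sum_range_succ, pentagonalTerm, hexp', hexp]
      push_cast
      ring
  rw [hE] at h
  convert dvd_sub h (hM.mul_left ((-1) ^ M * (3 * (M : R⟦X⟧)))) using 1
  ring

theorem mainIdentity_one_sub_div_one_add :
    MainIdentity (fun j => qDiv (1 - X ^ j) (1 + X ^ j : R⟦X⟧))
      (fun d => qDiv (2 * X ^ d) (1 - X ^ (2 * d)))
      (4 * ∑' r : ℕ, squareTerm R (r + 1)) := by
  have hc : ∀ d, (X : R⟦X⟧) ^ d ∣ qDiv (2 * X ^ d) (1 - X ^ (2 * d)) := fun d =>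
    dvd_qDiv _ (Dvd.intro_left _ rfl)
  have hb : ∀ j, (X : R⟦X⟧) ^ j ∣ qDiv (1 - X ^ j) (1 + X ^ j) - 1 := fun j => by
    rcases Nat.eq_zero_or_pos j with rfl | hj
    · simp
    · exact dvd_qDiv_sub_one (isUnit_one_add_X_pow hj.ne') ⟨-2, by ring⟩
  refine mainIdentity_of_X_pow_dvd hb hc (tendsto_sum_range_of_X_pow_dvd hc)
    ((tendsto_sum_range_of_X_pow_dvd (X_pow_dvd_squareTerm R)).const_mul 4) (fun M => ?_) rfl
  have hM : (X : R⟦X⟧) ^ M ∣ X ^ (M ^ 2) := pow_dvd_pow _ (by nlinarith)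
  have h := (pow_dvd_sum_tails_rogersFine (X : R⟦X⟧) (-1)
    (fun k => qDiv (1 - X ^ (k + 1)) (1 + X ^ (k + 1)))
    (fun k => qDiv (2 * X ^ (k + 1)) (1 - X ^ (2 * (k + 1))))
    (fun k => (1 + ε) ^ (2 * k) * inl ((-1) ^ k * X ^ (k ^ 2)))
    (fun k => by
      rw [neg_one_mul, sub_neg_eq_add, qDiv_mul_cancel _ (isUnit_one_add_X_pow k.succ_ne_zero)])
    (fun k => by
      have hu := isUnit_one_add_X_pow (R := R) (n := k + 1) k.succ_ne_zero
      have h1 := qDiv_mul_cancel (1 - X ^ (k + 1)) hu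
      have h2 := qDiv_mul_cancel (2 * X ^ (k + 1))
        (isUnit_one_sub_X_pow (R := R) (n := 2 * (k + 1)) (by omega))
      refine hu.mul_right_cancel ?_
      linear_combination h2 - X ^ (k + 1) * h1)
    (by simp)
    (fun k => by
      simp only [inl_mul, ← inl_pow, inl_neg, inl_one]
      ring)
    M ((map_dvd (inlHom R⟦X⟧ R⟦X⟧) (hM.mul_left _)).mul_left _)).2
  simp only [DualNumber.snd_one_add_eps_pow_mul_inl] at h
  -- After the same regrouping the two halves share the exponent (k+1)², and 2(k+1) + 2(k+1)
  -- explains the factor 4.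
  have hE : ∑ k ∈ Finset.range M, (((2 * k : ℕ) : R⟦X⟧) * ((-1) ^ k * X ^ (k ^ 2)) -
      (((2 * k : ℕ) : R⟦X⟧) + 2) * ((-1) ^ k * X ^ (k ^ 2) * X ^ (2 * k + 1))) =
      4 * ∑ k ∈ Finset.range M, squareTerm R (k + 1) -
        (-1) ^ M * (2 * (M : R⟦X⟧)) * X ^ (M ^ 2) := by
    clear h hM
    induction M with
    | zero => simp
    | succ M ih =>
      rw [Finset.sum_range_succ, ih, Finset.sum_range_succ, squareTerm]
      push_cast
      ring
  rw [hE] at h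
  convert dvd_sub h (hM.mul_left ((-1) ^ M * (2 * (M : R⟦X⟧)))) using 1
  ring

theorem mainIdentity_even_div_odd :
    MainIdentity (fun j => qDiv (1 - X ^ (2 * j)) (1 - X ^ (2 * j + 1) : R⟦X⟧))
      (fun d => qDiv ((-1) ^ d * X ^ d) (1 - X ^ d))
      ((1 - X) * ∑' r : ℕ, triangularTerm R (r + 1)) := by
  have hc : ∀ d, (X : R⟦X⟧) ^ d ∣ qDiv ((-1) ^ d * X ^ d) (1 - X ^ d) := fun d =>
    dvd_qDiv _ (Dvd.intro_left _ rfl)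
  have hb : ∀ j, (X : R⟦X⟧) ^ j ∣ qDiv (1 - X ^ (2 * j)) (1 - X ^ (2 * j + 1)) - 1 := fun j => by
    refine dvd_qDiv_sub_one (isUnit_one_sub_X_pow (by omega)) ?_
    rw [sub_sub_sub_cancel_left]
    exact dvd_sub (pow_dvd_pow _ (by omega)) (pow_dvd_pow _ (by omega))
  have hdouble : Tendsto (fun M : ℕ => 2 * M) atTop atTop :=
    tendsto_id.const_mul_atTop' two_pos
  set c : ℕ → R⟦X⟧ := fun d => qDiv ((-1) ^ d * X ^ d) (1 - X ^ d) with hcdef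
  have key := X_pow_dvd_sum_tails_even_div_odd R
  have hmul := multipliable_of_X_pow_dvd fun j => (pow_dvd_pow _ j.le_succ).trans (hb (j + 1))
  -- The undifferentiated identity at x = 1 sums this series to the infinite product.
  have hFlim : Tendsto (fun M => ∑ k ∈ Finset.range M,
      (X : R⟦X⟧) ^ (k * (2 * k + 1)) * (1 - X) * (1 + X ^ (2 * k + 1))) atTop
      (𝓝 (∏' j : ℕ, qDiv (1 - X ^ (2 * (j + 1))) (1 - X ^ (2 * (j + 1) + 1)))) := by
    have := hmul.hasProd.tendsto_prod_nat.sub (tendsto_zero_of_X_pow_dvd fun M => (key M).1)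
    simpa using this
  have hT : Tendsto (fun M => ∑ m ∈ Finset.range M, triangularTerm R m) atTop
      (𝓝 (∑' r : ℕ, triangularTerm R (r + 1))) := by
    rw [← tendsto_add_atTop_iff_nat 1]
    refine (tendsto_sum_range_of_X_pow_dvd (X_pow_dvd_triangularTerm R)).congr fun M => ?_
    rw [Finset.sum_range_succ']
    simp [triangularTerm]
  have hD : Tendsto (fun M => ∑ d ∈ Finset.range M, c (d + 1 + 1)) atTop
      (𝓝 (∑' d : ℕ, c (d + 1) - c 1)) := by
    have := ((tendsto_sum_range_of_X_pow_dvd hc).comp (tendsto_add_atTop_nat 1)).sub_const (c 1)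
    refine this.congr fun M => ?_
    simp [hcdef, Finset.sum_range_succ' _ M]
  refine mainIdentity_of_X_pow_dvd hb hc (hD.comp hdouble)
    (((hT.comp hdouble).const_mul (1 - X)).sub (hFlim.const_mul (qDiv X (1 - X))))
    (fun M => (key M).2) ?_
  -- The factors start at 1 - X^2, so `D` lacks d = 1; the -X/(1 - X) multiple of the product in `E`
  -- is exactly that term.
  have hc1 : c 1 = - qDiv X (1 - X) := by simp [hcdef, qDiv]
  rw [hc1]
  ring

end Identities

theorem theorem1 (R : Type*) [CommRing R] [TopologicalSpace R] [DiscreteTopology R]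
    (q : R⟦X⟧) (hq : q = PowerSeries.X) :
    -- case (i)
    MainIdentity (fun j => qDiv 1 (1 - q ^ j)) (fun d => qDiv (q ^ d) (1 - q ^ d)) 0 ∧
    -- case (ii)
    MainIdentity (fun j => qDiv (1 + q ^ j) (1 - q ^ j))
      (fun d => qDiv (2 * q ^ d) (1 - q ^ (2 * d))) 0 ∧
    -- case (iii)
    MainIdentity (fun j => qDiv (1 - q ^ (2 * j - 1)) (1 - q ^ (2 * j)))
      (fun d => qDiv ((-1) ^ d * q ^ d) (1 - q ^ d)) 0 ∧
    -- case (iv)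
    (Summable (fun r : ℕ => pentagonalTerm R (r + 1)) ∧
      MainIdentity (fun j => 1 - q ^ j) (fun d => qDiv (q ^ d) (1 - q ^ d))
        (∑' r : ℕ, pentagonalTerm R (r + 1))) ∧
    -- case (v)
    (Summable (fun r : ℕ => squareTerm R (r + 1)) ∧
      MainIdentity (fun j => qDiv (1 - q ^ j) (1 + q ^ j))
        (fun d => qDiv (2 * q ^ d) (1 - q ^ (2 * d)))
        (4 * ∑' r : ℕ, squareTerm R (r + 1))) ∧
    -- case (vi)
    (Summable (fun r : ℕ => triangularTerm R (r + 1)) ∧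
      MainIdentity (fun j => qDiv (1 - q ^ (2 * j)) (1 - q ^ (2 * j + 1)))
        (fun d => qDiv ((-1) ^ d * q ^ d) (1 - q ^ d))
        ((1 - q) * ∑' r : ℕ, triangularTerm R (r + 1))) := by
  subst hq
  have hsum : ∀ f : ℕ → R⟦X⟧, (∀ r, PowerSeries.X ^ r ∣ f r) → Summable fun r => f (r + 1) :=
    fun f hf => summable_of_X_pow_dvd fun r => (pow_dvd_pow _ r.le_succ).trans (hf (r + 1))
  exact ⟨mainIdentity_inv_one_sub R, mainIdentity_one_add_div_one_sub R,
    mainIdentity_odd_div_even R,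
    ⟨hsum _ (X_pow_dvd_pentagonalTerm R), mainIdentity_one_sub R⟩,
    ⟨hsum _ (X_pow_dvd_squareTerm R), mainIdentity_one_sub_div_one_add R⟩,
    ⟨hsum _ (X_pow_dvd_triangularTerm R), mainIdentity_even_div_odd R⟩⟩
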